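/- Let $n\ge 1$, and for each site $k\in\{1,\dots,n\}$ let $d_k$ be a physical dimension, $\sigma_k\in\mathbb R$, and $\phi_k$ a feature map from the $k$-th input space to $\mathbb R^{d_k}$. For bond dimensions $\alpha=(\alpha_1,\dots,\alpha_n)$, $\alpha_k\ge 1$, with the cyclic convention $\alpha_{n+1}=\alpha_1$, a matrix product state (MPS) has tensors $A^{(k)}=(A^{(k),s}_{ab})$ with $1\le s\le d_k$, $1\le a\le\alpha_k$, $1\le b\le\alpha_{k+1}$, and its output on $\mathbf x=(x_1,\dots,x_n)$ is $$\Psi(\mathbf x;\mathbf A)=\sum_{s_1,\dots,s_n}\ \sum_{a_1,\dots,a_n}A^{(1),s_1}_{a_1a_2}A^{(2),s_2}_{a_2a_3}\cdots A^{(n),s_n}_{a_na_1}\prod_{k=1}^n\phi_k^{s_k}(x_k).$$ Its neural tangent kernel (NTK) is $$K(\mathbf x,\mathbf y)=\sum_{k=1}^n\eta_k\sum_{s,a,b}\frac{\partial\Psi(\mathbf x)}{\partial A^{(k),s}_{ab}}\,\frac{\partial\Psi(\mathbf y)}{\partial A^{(k),s}_{ab}},\qquad \eta_k=(\alpha_k\alpha_{k+1})^{-1/2}.$$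 For every $\alpha$, let the tensors be initialized with independent entries $A^{(k),s}_{ab}\sim\mathcal N\!\big(0,\ \sigma_k^2/\sqrt{\alpha_k\alpha_{k+1}}\big)$. Let $\mathbf x^{(1)},\dots,\mathbf x^{(m)}$ be fixed inputs. Then, as the bond dimensions go to infinity sequentially, one after another, in any order $\alpha_{\pi(1)},\dots,\alpha_{\pi(n)}$, the random $m\times m$ matrix $\big(K(\mathbf x^{(i)},\mathbf x^{(j)})\big)_{i,j}$ at initialization converges in probability to the deterministic matrix $K_\infty$ with the entries $$K_\infty(\mathbf x^{(i)},\mathbf x^{(j)})=\sum_{k=1}^n\phi_k(x^{(i)}_k)\cdot\phi_k(x^{(j)}_k)\prod_{l\ne k}\sigma_l^2\,\phi_l(x^{(i)}_l)\cdot\phi_l(x^{(j)}_l).$$ Here sequential convergence in probability means that for all $\varepsilon,\delta>0$, for all sufficiently large $\alpha_{\pi(n)}$, for all sufficiently large $\alpha_{\pi(n-1)}$ (depending on $\alpha_{\pi(n)}$), and so on down to all sufficiently large $\alpha_{\pi(1)}$ (depending on all the others), one has $\mathbb P\big(\max_{i,j}|K(\mathbf x^{(i)},\mathbf x^{(j)})-K_\infty(\mathbf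 x^{(i)},\mathbf x^{(j)})|\ge\varepsilon\big)\le\delta$. -/

import Mathlib

/-!
The derivative of the output with respect to an entry of the tensor at site `k` is a feature times
an entry of the environment of `k`, the product of all other matrices around the cycle. Hence
`K(x, y) = ∑ k, (φ_k(x_k) · φ_k(y_k)) η_k O_k`, where `O_k` is the Frobenius inner product of the
environments of `k` for `x` and `y`. This `O_k` is itself a cyclic trace, of independent random
matrices indexed by pairs of bond indices, so its moments can be computed site by site.

The mean of `η_k O_k` equals `∏_{l ≠ k} σ_l² φ_l(x_l) · φ_l(y_l)` for all bond dimensions. In the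
second moment, Isserlis' theorem makes every site choose one of the three pairings of four bond
indices. Whenever the choices at sites `l - 1` and `l` differ, the sum over the bond `l` between
them loses a factor `α_l`, while site `k`, which carries no tensor, has only one pairing. As all
`α_l → ∞` only the constant choice survives, and it contributes the square of the mean. So the
variance tends to zero, and Chebyshev's inequality gives convergence in probability along every
filter on which all bond dimensions tend to infinity, in particular along the sequential ones.
-/

open MeasureTheory ProbabilityTheory Filter Topology

noncomputable section

namespace MPS

/-- The scalar parameters of a periodic matrix product state with `n` sites, physical dimensions
`d k` and bond dimensions `α k`: the tensor at site `k` has the entries `A^s_{a b}` with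
`s < d k`, `a < α k`, `b < α (k + 1)`. Addition in `Fin n` is cyclic, so that the last tensor
carries the bond indices `(α_n, α_1)`. -/
abbrev Param {n : ℕ} [NeZero n] (d : Fin n → ℕ) (α : Fin n → ℕ+) : Type :=
  (k : Fin n) × (Fin (d k) × Fin (α k : ℕ) × Fin (α (k + 1) : ℕ))

/-- The output
`Ψ(x; A) = ∑_{s, a} A^{s_1}_{a_1 a_2} ⋯ A^{s_n}_{a_n a_1} φ^{s_1}(x_1) ⋯ φ^{s_n}(x_n)`. -/
def output {n : ℕ} [NeZero n] {d : Fin n → ℕ} {X : Fin n → Type*}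
    (φ : (k : Fin n) → X k → Fin (d k) → ℝ) (α : Fin n → ℕ+)
    (A : Param d α → ℝ) (x : (k : Fin n) → X k) : ℝ :=
  ∑ s : ((k : Fin n) → Fin (d k)), ∑ a : ((k : Fin n) → Fin (α k : ℕ)),
    (∏ k, A ⟨k, s k, a k, a (k + 1)⟩) * ∏ k, φ k (x k) (s k)

/-- The partial derivative of `Ψ(x; ·)` at `A` with respect to the entry `p`. -/
def partialOutput {n : ℕ} [NeZero n] {d : Fin n → ℕ} {X : Fin n → Type*}
    (φ : (k : Fin n) → X k → Fin (d k) → ℝ) (α : Fin n → ℕ+)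
    (A : Param d α → ℝ) (x : (k : Fin n) → X k) (p : Param d α) : ℝ :=
  deriv (fun t : ℝ => output φ α (Function.update A p t) x) (A p)

/-- The learning rate `(α_k α_{k+1})^{-1/2}` of the entries of the tensor at site `k`. -/
def learningRate {n : ℕ} [NeZero n] (α : Fin n → ℕ+) (k : Fin n) : ℝ :=
  ((α k : ℝ) * (α (k + 1) : ℝ)) ^ (-(1 / 2) : ℝ)

/-- The neural tangent kernel
`K(x, y) = ∑_p η_p (∂Ψ(x)/∂A_p) (∂Ψ(y)/∂A_p)`, the sum running over all scalar parameters. -/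
def ntk {n : ℕ} [NeZero n] {d : Fin n → ℕ} {X : Fin n → Type*}
    (φ : (k : Fin n) → X k → Fin (d k) → ℝ) (α : Fin n → ℕ+)
    (A : Param d α → ℝ) (x y : (k : Fin n) → X k) : ℝ :=
  ∑ p : Param d α, learningRate α p.1 * (partialOutput φ α A x p * partialOutput φ α A y p)

/-- The deterministic kernel
`∑_k φ(x_k)·φ(y_k) ∏_{l ≠ k} σ_l² φ(x_l)·φ(y_l)`. -/
def limitKernel {n : ℕ} {d : Fin n → ℕ} {X : Fin n → Type*}
    (φ : (k : Fin n) → X k → Fin (d k) → ℝ) (σ : Fin n → ℝ)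
    (x y : (k : Fin n) → X k) : ℝ :=
  ∑ k, (φ k (x k) ⬝ᵥ φ k (y k)) *
    ∏ l ∈ Finset.univ.erase k, σ l ^ 2 * (φ l (x l) ⬝ᵥ φ l (y l))

/-- The variance `σ_k² / √(α_k α_{k+1})` of the entries of the tensor at site `k`. -/
def initVariance {n : ℕ} [NeZero n] (σ : Fin n → ℝ) (α : Fin n → ℕ+) (k : Fin n) : NNReal :=
  ⟨σ k ^ 2 / √((α k : ℝ) * (α (k + 1) : ℝ)), by positivity⟩

/-- The random parameters `A` are initialized at bond dimensions `α`: all entries are independent,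
and those of the tensor at site `k` are centred Gaussian with variance
`σ_k² / √(α_k α_{k+1})`. -/
structure IsGaussianInit {n : ℕ} [NeZero n] {d : Fin n → ℕ} {Ω : Type*} [MeasurableSpace Ω]
    (μ : Measure Ω) (σ : Fin n → ℝ) (α : Fin n → ℕ+) (A : Ω → Param d α → ℝ) : Prop where
  indep : iIndepFun (fun (p : Param d α) (ω : Ω) => A ω p) μ
  law : ∀ p : Param d α, HasLaw (fun ω => A ω p) (gaussianReal 0 (initVariance σ α p.1)) μ

/-- The filter of an iterated limit in some of the coordinates, the others being kept as in `α`.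
The list gives the coordinates from the outermost (last) limit to the innermost (first) one:
`P` holds eventually along `iteratedAtTop [k_r, …, k_1] α` if and only if
`∀ᶠ N_r, …, ∀ᶠ N_1`, `P` holds at `α` with the coordinates `k_j` replaced by `N_j`. -/
def iteratedAtTop {n : ℕ} : List (Fin n) → (Fin n → ℕ+) → Filter (Fin n → ℕ+)
  | [], α => pure α
  | k :: ks, α =>
      Filter.bind (atTop : Filter ℕ+) fun N => iteratedAtTop ks (Function.update α k N)

/-- The filter on bond dimensions which go to infinity one after another, in the order
`π 0, π 1, …, π (n - 1)`: the limit in coordinate `π 0` is taken first, with all the others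
fixed, and the one in coordinate `π (n - 1)` last. All coordinates occur, so that the starting
value `1` plays no role. -/
def sequentialAtTop {n : ℕ} (π : Equiv.Perm (Fin n)) : Filter (Fin n → ℕ+) :=
  iteratedAtTop (List.ofFn π).reverse 1

end MPS

end

noncomputable section

namespace MPS

section GaussianMoments

theorem integral_pow_add_two_gaussianReal (v : NNReal) (m : ℕ) :
    ∫ x, x ^ (m + 2) ∂(gaussianReal 0 v) = (m + 1) * v * ∫ x, x ^ m ∂(gaussianReal 0 v) := by
  set M : ℝ → ℝ := fun t => Real.exp (v * t ^ 2 / 2)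
  have hMsmooth : ContDiff ℝ ⊤ M := by fun_prop
  have integral_eq (j : ℕ) : ∫ x, x ^ j ∂(gaussianReal 0 v) = iteratedDeriv j M 0 := by
    have h := iteratedDeriv_mgf_zero (X := fun x : ℝ => x) (μ := gaussianReal 0 v) (by simp) j
    simpa [mgf_fun_id_gaussianReal] using h.symm
  have hderiv : deriv M = fun t => (v * t) * M t := by
    funext t
    have h := (((hasDerivAt_pow 2 t).const_mul (v : ℝ)).div_const 2).exp
    rw [h.deriv]
    norm_num
    ring
  rw [integral_eq, integral_eq, iteratedDeriv_succ', hderiv,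
    iteratedDeriv_fun_mul (by fun_prop) (hMsmooth.of_le le_top).contDiffAt,
    Finset.sum_eq_single 1]
  · simp
  · intro i _ hi
    have hlinear : iteratedDeriv i (fun t : ℝ => v * t) 0 = 0 := by
      rw [iteratedDeriv_const_mul_field, iteratedDeriv_fun_id_zero, if_neg hi, mul_zero]
    rw [hlinear, mul_zero, zero_mul]
  · simp

theorem integral_pow_four_gaussianReal (v : NNReal) :
    ∫ x, x ^ 4 ∂(gaussianReal 0 v) = 3 * (v : ℝ) ^ 2 := by
  rw [integral_pow_add_two_gaussianReal v 2, integral_pow_add_two_gaussianReal v 0]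
  norm_num
  ring

variable {E : Type*} [NormedAddCommGroup E] [NormedSpace ℝ E] [MeasurableSpace E] [BorelSpace E]
  {μ : Measure E} [IsGaussian μ]

variable (μ) in
theorem memLp_two_dual_mul_dual (L₁ L₂ : StrongDual ℝ E) :
    MemLp (fun x => L₁ x * L₂ x) 2 μ := by
  have : ENNReal.HolderTriple 4 4 2 := ⟨by
    rw [show (4 : ENNReal) = 2 * 2 by norm_num, ENNReal.mul_inv (by simp) (by simp), ← mul_add,
      ENNReal.inv_two_add_inv_two, mul_one]⟩
  exact (IsGaussian.memLp_dual μ L₂ 4 (by simp)).mul' (IsGaussian.memLp_dual μ L₁ 4 (by simp))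

variable (μ) in
theorem integrable_dual_mul_four (L₁ L₂ L₃ L₄ : StrongDual ℝ E) :
    Integrable (fun x => L₁ x * L₂ x * (L₃ x * L₄ x)) μ :=
  (memLp_two_dual_mul_dual μ L₁ L₂).integrable_mul (memLp_two_dual_mul_dual μ L₃ L₄)

variable [CompleteSpace E] [SecondCountableTopology E]

theorem integral_dual_eq_zero (hμ : ∫ x, x ∂μ = 0) (L : StrongDual ℝ E) : ∫ x, L x ∂μ = 0 := by
  rw [IsGaussian.integral_dual, hμ, map_zero]

theorem integral_dual_mul_dual (hμ : ∫ x, x ∂μ = 0) (L₁ L₂ : StrongDual ℝ E) :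
    ∫ x, L₁ x * L₂ x ∂μ = covarianceBilinDual μ L₁ L₂ := by
  rw [covarianceBilinDual_eq_covariance IsGaussian.memLp_two_id, covariance]
  simp only [integral_dual_eq_zero hμ, sub_zero]

theorem integral_dual_pow_four (hμ : ∫ x, x ∂μ = 0) (L : StrongDual ℝ E) :
    ∫ x, L x ^ 4 ∂μ = 3 * covarianceBilinDual μ L L ^ 2 := by
  have hlaw := IsGaussian.map_eq_gaussianReal (μ := μ) L
  rw [integral_dual_eq_zero hμ, ← covarianceBilinDual_self_eq_variance IsGaussian.memLp_two_id]
    at hlaw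
  rw [← integral_map (f := fun t => t ^ 4) (by fun_prop) (by fun_prop), hlaw,
    integral_pow_four_gaussianReal,
    Real.coe_toNNReal _ (covarianceBilinDual_self_nonneg L)]

theorem integral_dual_sq_mul_dual_sq (hμ : ∫ x, x ∂μ = 0) (L₁ L₂ : StrongDual ℝ E) :
    ∫ x, L₁ x ^ 2 * L₂ x ^ 2 ∂μ =
      covarianceBilinDual μ L₁ L₁ * covarianceBilinDual μ L₂ L₂ +
        2 * covarianceBilinDual μ L₁ L₂ ^ 2 := by
  have hint (L : StrongDual ℝ E) : Integrable (fun x => L x ^ 4) μ :=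
    (integrable_dual_mul_four μ L L L L).congr (ae_of_all _ fun x => by ring)
  have polarization (x : E) : L₁ x ^ 2 * L₂ x ^ 2 =
      12⁻¹ * ((L₁ + L₂) x ^ 4 + (L₁ - L₂) x ^ 4 - 2 * L₁ x ^ 4 - 2 * L₂ x ^ 4) := by
    simp only [add_apply, sub_apply]
    ring
  simp_rw [polarization]
  rw [integral_const_mul,
    integral_sub, integral_sub, integral_add, integral_const_mul, integral_const_mul]
  rotate_left
  any_goals fun_prop
  simp only [integral_dual_pow_four hμ]
  simp only [map_add, map_sub, add_apply, sub_apply, covarianceBilinDual_comm L₂ L₁]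
  ring

/-- **Isserlis' theorem** for four linear functionals. -/
theorem integral_dual_mul_four (hμ : ∫ x, x ∂μ = 0) (L₁ L₂ L₃ L₄ : StrongDual ℝ E) :
    ∫ x, L₁ x * L₂ x * (L₃ x * L₄ x) ∂μ =
      covarianceBilinDual μ L₁ L₂ * covarianceBilinDual μ L₃ L₄ +
      covarianceBilinDual μ L₁ L₃ * covarianceBilinDual μ L₂ L₄ +
      covarianceBilinDual μ L₁ L₄ * covarianceBilinDual μ L₂ L₃ := by
  have hint (L M : StrongDual ℝ E) : Integrable (fun x => L x ^ 2 * M x ^ 2) μ :=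
    (integrable_dual_mul_four μ L L M M).congr (ae_of_all _ fun x => by ring)
  have polarization (x : E) : L₁ x * L₂ x * (L₃ x * L₄ x) =
      16⁻¹ * ((L₁ + L₂) x ^ 2 * (L₃ + L₄) x ^ 2 - (L₁ + L₂) x ^ 2 * (L₃ - L₄) x ^ 2 -
        ((L₁ - L₂) x ^ 2 * (L₃ + L₄) x ^ 2 - (L₁ - L₂) x ^ 2 * (L₃ - L₄) x ^ 2)) := by
    simp only [add_apply, sub_apply]
    ring
  simp_rw [polarization]
  rw [integral_const_mul,
    integral_sub, integral_sub, integral_sub]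
  rotate_left
  any_goals fun_prop
  simp only [integral_dual_sq_mul_dual_sq hμ]
  simp only [map_add, map_sub, add_apply, sub_apply, covarianceBilinDual_comm L₂ L₁,
    covarianceBilinDual_comm L₄ L₃]
  ring

end GaussianMoments

section ProductMeasure

instance isGaussian_pi {J : Type*} [Fintype J] {E : J → Type*} [∀ j, NormedAddCommGroup (E j)]
    [∀ j, NormedSpace ℝ (E j)] [∀ j, MeasurableSpace (E j)] [∀ j, BorelSpace (E j)]
    [∀ j, CompleteSpace (E j)] [∀ j, SecondCountableTopology (E j)]
    (ν : ∀ j, Measure (E j)) [∀ j, IsGaussian (ν j)] : IsGaussian (Measure.pi ν) := by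
  have hlaw (j : J) : HasGaussianLaw (fun x : ∀ j, E j => x j) (Measure.pi ν) :=
    ⟨by rw [(measurePreserving_eval ν j).map_eq]; infer_instance⟩
  have hindep : iIndepFun (fun j (x : ∀ j, E j) => x j) (Measure.pi ν) :=
    iIndepFun_pi (X := fun _ => id) fun _ => aemeasurable_id
  simpa using (iIndepFun.hasGaussianLaw hlaw hindep).isGaussian_map

variable {J : Type*} [Fintype J]

/-- The linear form `x ↦ u ⬝ᵥ x`, bundled as an element of the dual of `J → ℝ`. -/
def dotProductDual (u : J → ℝ) : StrongDual ℝ (J → ℝ) :=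
  (dotProductBilin ℝ ℝ u).toContinuousLinearMap

@[simp]
theorem dotProductDual_apply (u x : J → ℝ) : dotProductDual u x = u ⬝ᵥ x := rfl

theorem integral_id_pi_gaussianReal (v : NNReal) :
    ∫ x, x ∂(Measure.pi fun _ : J => gaussianReal 0 v) = 0 := by
  funext j
  rw [eval_integral (f := fun x : J → ℝ => x) fun j =>
      (IsGaussian.memLp_dual _ (.proj (R := ℝ) (φ := fun _ : J => ℝ) j) 1 (by simp)).integrable
        le_rfl,
    integral_comp_eval (X := fun _ : J => ℝ) (i := j) (f := fun x : ℝ => x) (by fun_prop)]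
  simp

theorem covarianceBilinDual_pi_gaussianReal (v : NNReal) (u w : J → ℝ) :
    covarianceBilinDual (Measure.pi fun _ : J => gaussianReal 0 v)
      (dotProductDual u) (dotProductDual w) = v * (u ⬝ᵥ w) := by
  classical
  set ν := Measure.pi fun _ : J => gaussianReal 0 v
  have hmem (j : J) : MemLp (fun x : J → ℝ => x j) 2 ν :=
    IsGaussian.memLp_dual ν (.proj (R := ℝ) (φ := fun _ : J => ℝ) j) 2 (by simp)
  have hindep : iIndepFun (fun j (x : J → ℝ) => x j) ν :=
    iIndepFun_pi (X := fun _ => id) fun _ => aemeasurable_id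
  have hcov (i j : J) : cov[fun x : J → ℝ => x i, fun x => x j; ν] =
      if i = j then (v : ℝ) else 0 := by
    split_ifs with h
    · subst h
      have hlaw : HasLaw (fun x : J → ℝ => x i) (gaussianReal 0 v) ν :=
        (measurePreserving_eval (fun _ : J => gaussianReal 0 v) i).hasLaw
      rw [covariance_self hlaw.aemeasurable, hlaw.variance_eq, variance_id_gaussianReal]
    · exact (hindep.indepFun h).covariance_eq_zero (hmem i) (hmem j)
  rw [covarianceBilinDual_eq_covariance IsGaussian.memLp_two_id]
  calc cov[fun x => ∑ j, u j * x j, fun x => ∑ j, w j * x j; ν]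
      = ∑ i, ∑ j, u i * w j * cov[fun x : J → ℝ => x i, fun x => x j; ν] := by
        rw [covariance_fun_sum_fun_sum (fun j => (hmem j).const_mul (u j))
          (fun j => (hmem j).const_mul (w j))]
        simp only [covariance_const_mul_left, covariance_const_mul_right, mul_assoc,
          mul_left_comm (w _)]
    _ = v * (u ⬝ᵥ w) := by
        simp only [hcov, mul_ite, mul_zero, Finset.sum_ite_eq, Finset.mem_univ, if_true,
          dotProduct, ← Finset.sum_mul, mul_comm (v : ℝ)]

end ProductMeasure

section CyclicTrace

variable {R : Type*} [CommSemiring R] {n : ℕ} [NeZero n] {β γ : Fin n → Type*}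
  [∀ l, Fintype (β l)] [∀ l, Fintype (γ l)]

/-- The trace of the cyclic matrix product `T₀ T₁ ⋯ Tₙ₋₁`, as a multilinear map. It is defined by
summing over the bond configurations, since the matrices have different index types. -/
def cyclicTrace : MultilinearMap R (fun l => Matrix (β l) (β (l + 1)) R) R :=
  ∑ c : ∀ l, β l, (MultilinearMap.mkPiAlgebra R (Fin n) R).compLinearMap fun l =>
    Matrix.entryLinearMap R R (c l) (c (l + 1))

theorem cyclicTrace_apply (T : ∀ l, Matrix (β l) (β (l + 1)) R) :
    cyclicTrace T = ∑ c : ∀ l, β l, ∏ l, T l (c l) (c (l + 1)) := by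
  simp [cyclicTrace]

open scoped Kronecker in
theorem cyclicTrace_mul_cyclicTrace (S : ∀ l, Matrix (β l) (β (l + 1)) R)
    (T : ∀ l, Matrix (γ l) (γ (l + 1)) R) :
    cyclicTrace S * cyclicTrace T = cyclicTrace (β := fun l => β l × γ l) fun l => S l ⊗ₖ T l := by
  simp only [cyclicTrace_apply, Finset.sum_mul_sum, ← Finset.prod_mul_distrib,
    ← Fintype.sum_prod_type']
  exact ((Equiv.arrowProdEquivProdArrow (Fin n) β γ).sum_comp _).symm

theorem cyclicTrace_vecMulVec (f g : ∀ l, β l → R) :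
    cyclicTrace (fun l => Matrix.vecMulVec (f l) (g (l + 1))) = ∏ l, f l ⬝ᵥ g l := by
  simp only [cyclicTrace_apply, Matrix.vecMulVec_apply, dotProduct, Fintype.prod_sum,
    Finset.prod_mul_distrib]
  refine Finset.sum_congr rfl fun c _ => congrArg _ ?_
  exact Equiv.prod_comp (Equiv.addRight (1 : Fin n)) fun l => g l (c l)

theorem cyclicTrace_smul_vecMulVec (w : Fin n → R) (f g : ∀ l, β l → R) :
    cyclicTrace (fun l => w l • Matrix.vecMulVec (f l) (g (l + 1))) =
      (∏ l, w l) * ∏ l, f l ⬝ᵥ g l := by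
  rw [MultilinearMap.map_smul_univ, cyclicTrace_vecMulVec, smul_eq_mul]

theorem cyclicTrace_sum_smul_vecMulVec {κ : Type*} [Fintype κ] (w : Fin n → κ → R)
    (h : ∀ l, κ → β l → R) :
    cyclicTrace (fun l => ∑ q, w l q • Matrix.vecMulVec (h l q) (h (l + 1) q)) =
      ∑ p : Fin n → κ, (∏ l, w l (p l)) * ∏ l, h l (p l) ⬝ᵥ h l (p (l - 1)) := by
  classical
  rw [MultilinearMap.map_sum]
  refine Finset.sum_congr rfl fun p _ => ?_
  simpa using cyclicTrace_smul_vecMulVec (fun l => w l (p l)) (fun l => h l (p l))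
    (fun l => h l (p (l - 1)))

end CyclicTrace

section Kernel

/-- The matrix `∑_s f^s ω^s` obtained by contracting the physical index of a site tensor `ω` with
a feature vector `f`. -/
def contract {r N M : ℕ} (f : Fin r → ℝ) (ω : Fin r × Fin N × Fin M → ℝ) :
    Matrix (Fin N) (Fin M) ℝ :=
  Matrix.of fun a b => ∑ s, ω (s, a, b) * f s

theorem contract_update {r N M : ℕ} (f : Fin r → ℝ) (ω : Fin r × Fin N × Fin M → ℝ) (s : Fin r)
    (a : Fin N) (b : Fin M) (t : ℝ) :
    contract f (Function.update ω (s, a, b) t) =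
      contract f ω + ((t - ω (s, a, b)) * f s) • Matrix.single a b 1 := by
  ext a' b'
  by_cases h : a = a' ∧ b = b'
  · obtain ⟨rfl, rfl⟩ := h
    simp only [contract, Matrix.of_apply, Matrix.add_apply, Matrix.smul_apply,
      Matrix.single_apply_same, smul_eq_mul, mul_one]
    rw [← sub_eq_iff_eq_add', ← Finset.sum_sub_distrib, Finset.sum_eq_single s]
    · simp [sub_mul]
    · intro s' _ hs
      rw [Function.update_of_ne (by simpa using hs), sub_self]
    · simp
  · have (s' : Fin r) : (s', a', b') ≠ (s, a, b) := by
      simp only [ne_eq, Prod.mk.injEq]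
      grind
    simp [contract, Function.update_of_ne (this _), Matrix.single_apply_of_ne _ _ _ _ _ h]

variable {n : ℕ} [NeZero n] {d : Fin n → ℕ} {α : Fin n → ℕ+}

/-- Families of site tensors with physical dimensions `d` and bond dimensions `α`, the curried form
of the parameters. -/
abbrev SiteTensors (d : Fin n → ℕ) (α : Fin n → ℕ+) : Type :=
  (k : Fin n) → Fin (d k) × Fin (α k : ℕ) × Fin (α (k + 1) : ℕ) → ℝ

/-- The matrices of a matrix product state with the physical indices contracted with the feature
vectors `u`. -/
def siteMatrices (u : (k : Fin n) → Fin (d k) → ℝ) (W : SiteTensors d α) (l : Fin n) :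
    Matrix (Fin (α l : ℕ)) (Fin (α (l + 1) : ℕ)) ℝ :=
  contract (u l) (W l)

/-- The environment of the site `k`: the derivative of the cyclic trace with respect to the entry
`(a, b)` of the matrix at `k`. -/
def environment (u : (k : Fin n) → Fin (d k) → ℝ) (W : SiteTensors d α) (k : Fin n)
    (a : Fin (α k : ℕ)) (b : Fin (α (k + 1) : ℕ)) : ℝ :=
  cyclicTrace (Function.update (siteMatrices u W) k (Matrix.single a b 1))

theorem siteMatrices_update (u : (k : Fin n) → Fin (d k) → ℝ) (W : SiteTensors d α) (k : Fin n)
    (s : Fin (d k)) (a : Fin (α k : ℕ)) (b : Fin (α (k + 1) : ℕ)) (t : ℝ) :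
    siteMatrices u (Function.update W k (Function.update (W k) (s, a, b) t)) =
      Function.update (siteMatrices u W) k
        (siteMatrices u W k + ((t - W k (s, a, b)) * u k s) • Matrix.single a b 1) := by
  funext l
  rw [siteMatrices, Function.apply_update fun l => contract (u l), contract_update]
  rfl

variable {X : Fin n → Type*} (φ : (k : Fin n) → X k → Fin (d k) → ℝ)

theorem output_eq_cyclicTrace (A : Param d α → ℝ) (x : (k : Fin n) → X k) :
    output φ α A x = cyclicTrace (siteMatrices (fun l => φ l (x l)) (Sigma.curry A)) := by
  simp only [output, cyclicTrace_apply, siteMatrices, contract, Matrix.of_apply, Fintype.prod_sum,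
    Finset.prod_mul_distrib, Sigma.curry]
  exact Finset.sum_comm

theorem output_update (A : Param d α → ℝ) (x : (k : Fin n) → X k) (k : Fin n) (s : Fin (d k))
    (a : Fin (α k : ℕ)) (b : Fin (α (k + 1) : ℕ)) (t : ℝ) :
    output φ α (Function.update A ⟨k, s, a, b⟩ t) x =
      output φ α A x + (t - A ⟨k, s, a, b⟩) *
        (φ k (x k) s * environment (fun l => φ l (x l)) (Sigma.curry A) k a b) := by
  rw [output_eq_cyclicTrace, Sigma.curry_update, siteMatrices_update,
    MultilinearMap.map_update_add, MultilinearMap.map_update_smul, Function.update_eq_self,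
    smul_eq_mul, mul_assoc, output_eq_cyclicTrace]
  rfl

theorem partialOutput_eq (A : Param d α → ℝ) (x : (k : Fin n) → X k) (k : Fin n) (s : Fin (d k))
    (a : Fin (α k : ℕ)) (b : Fin (α (k + 1) : ℕ)) :
    partialOutput φ α A x ⟨k, s, a, b⟩ =
      φ k (x k) s * environment (fun l => φ l (x l)) (Sigma.curry A) k a b := by
  simp [partialOutput, output_update]

end Kernel

section Overlap

open scoped Kronecker

variable {r N M : ℕ}

theorem sum_single_kronecker_single {R β γ : Type*} [CommSemiring R] [Fintype β] [Fintype γ]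
    [DecidableEq β] [DecidableEq γ] :
    ∑ a : β, ∑ b : γ, Matrix.single a b (1 : R) ⊗ₖ Matrix.single a b (1 : R) =
      Matrix.vecMulVec (Matrix.vec 1) (Matrix.vec 1) := by
  ext ⟨a, a'⟩ ⟨b, b'⟩
  simp only [Matrix.sum_apply, Matrix.kroneckerMap_apply, Matrix.single_apply, ite_and, mul_ite,
    mul_one, mul_zero, Finset.sum_ite_irrel, Finset.sum_ite_eq', Finset.mem_univ, if_true,
    Finset.sum_const_zero, Matrix.vecMulVec_apply, Matrix.vec, Matrix.one_apply]
  split_ifs <;> rfl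

/-- The matrix of site `l` in the cyclic trace over pairs of bond indices which gives the overlap
of two environments of site `k`. -/
def pairMatrix {n : ℕ} (k l : Fin n) (f g : Fin r → ℝ) (w : Fin r × Fin N × Fin M → ℝ) :
    Matrix (Fin N × Fin N) (Fin M × Fin M) ℝ :=
  if l = k then Matrix.vecMulVec (Matrix.vec 1) (Matrix.vec 1) else contract f w ⊗ₖ contract g w

variable {n : ℕ} [NeZero n] {d : Fin n → ℕ} {α : Fin n → ℕ+}

/-- The Frobenius inner product of the environments of site `k` for the features `u` and `v`. -/
def overlap (u v : (k : Fin n) → Fin (d k) → ℝ) (k : Fin n) (W : SiteTensors d α) : ℝ :=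
  ∑ a, ∑ b, environment u W k a b * environment v W k a b

theorem overlap_eq_cyclicTrace (u v : (k : Fin n) → Fin (d k) → ℝ) (k : Fin n)
    (W : SiteTensors d α) :
    overlap u v k W = cyclicTrace (β := fun l => Fin (α l : ℕ) × Fin (α l : ℕ))
      fun l => pairMatrix k l (u l) (v l) (W l) := by
  have hpair : (fun l => pairMatrix k l (u l) (v l) (W l)) =
      Function.update (fun l => siteMatrices u W l ⊗ₖ siteMatrices v W l) k
        (Matrix.vecMulVec (Matrix.vec 1) (Matrix.vec 1)) := by
    funext l
    obtain rfl | h := eq_or_ne l k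
    · simp [pairMatrix]
    · simp [pairMatrix, h, siteMatrices]
  simp only [hpair, ← sum_single_kronecker_single, MultilinearMap.map_update_sum, overlap,
    environment, cyclicTrace_mul_cyclicTrace]
  refine Finset.sum_congr rfl fun a _ => Finset.sum_congr rfl fun b _ =>
    congrArg _ (funext fun l => ?_)
  obtain rfl | h := eq_or_ne l k
  · simp
  · simp [h]

theorem ntk_eq_sum_overlap {X : Fin n → Type*} (φ : (k : Fin n) → X k → Fin (d k) → ℝ)
    (A : Param d α → ℝ) (x y : (k : Fin n) → X k) :
    ntk φ α A x y = ∑ k, (φ k (x k) ⬝ᵥ φ k (y k)) *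
      (learningRate α k * overlap (fun l => φ l (x l)) (fun l => φ l (y l)) k (Sigma.curry A)) := by
  simp only [ntk, Fintype.sum_sigma, Fintype.sum_prod_type, partialOutput_eq]
  refine Finset.sum_congr rfl fun k _ => ?_
  rw [dotProduct, Finset.sum_mul]
  refine Finset.sum_congr rfl fun s _ => ?_
  simp only [overlap, Finset.mul_sum]
  exact Finset.sum_congr rfl fun a _ => Finset.sum_congr rfl fun b _ => by ring

end Overlap

section SiteMoments

open scoped Kronecker

variable {r N M : ℕ}

/-- The coefficient vector of the linear form `w ↦ contract f w a b`. -/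
def siteVector (f : Fin r → ℝ) (a : Fin N) (b : Fin M) : Fin r × Fin N × Fin M → ℝ :=
  fun j => f j.1 * ((1 : Matrix _ _ ℝ) a j.2.1 * (1 : Matrix _ _ ℝ) b j.2.2)

theorem contract_eq_dotProductDual (f : Fin r → ℝ) (w : Fin r × Fin N × Fin M → ℝ) (a : Fin N)
    (b : Fin M) : contract f w a b = dotProductDual (siteVector f a b) w := by
  simp [contract, siteVector, dotProduct, Fintype.sum_prod_type, Matrix.one_apply, mul_comm]

theorem siteVector_dotProduct_siteVector (f g : Fin r → ℝ) (a a' : Fin N) (b b' : Fin M) :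
    siteVector f a b ⬝ᵥ siteVector g a' b' =
      (f ⬝ᵥ g) * ((1 : Matrix _ _ ℝ) a a' * (1 : Matrix _ _ ℝ) b b') := by
  simp [siteVector, dotProduct, Fintype.sum_prod_type, Matrix.one_apply]

theorem pairMatrix_of_ne_apply {n : ℕ} {k l : Fin n} (h : l ≠ k) (f g : Fin r → ℝ)
    (w : Fin r × Fin N × Fin M → ℝ) (e : Fin N × Fin N) (e' : Fin M × Fin M) :
    pairMatrix k l f g w e e' =
      dotProductDual (siteVector f e.1 e'.1) w * dotProductDual (siteVector g e.2 e'.2) w := by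
  rw [← contract_eq_dotProductDual, ← contract_eq_dotProductDual, pairMatrix, if_neg h,
    Matrix.kroneckerMap_apply]

variable {n : ℕ} (k l : Fin n) (v : NNReal) (f g : Fin r → ℝ)

theorem memLp_two_pairMatrix (e : Fin N × Fin N) (e' : Fin M × Fin M) :
    MemLp (fun w => pairMatrix k l f g w e e') 2 (Measure.pi fun _ => gaussianReal 0 v) := by
  obtain rfl | h := eq_or_ne l k
  · simpa only [pairMatrix, if_true] using memLp_const _
  · simpa only [pairMatrix_of_ne_apply h] using memLp_two_dual_mul_dual _
      (dotProductDual (siteVector f e.1 e'.1)) (dotProductDual (siteVector g e.2 e'.2))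

theorem integrable_pairMatrix_kronecker_pairMatrix (e : (Fin N × Fin N) × (Fin N × Fin N))
    (e' : (Fin M × Fin M) × (Fin M × Fin M)) :
    Integrable (fun w => (pairMatrix k l f g w ⊗ₖ pairMatrix k l f g w) e e')
      (Measure.pi fun _ => gaussianReal 0 v) :=
  (memLp_two_pairMatrix k l v f g e.1 e'.1).integrable_mul
    (memLp_two_pairMatrix k l v f g e.2 e'.2)

theorem integral_pairMatrix (e : Fin N × Fin N) (e' : Fin M × Fin M) :
    ∫ w, pairMatrix k l f g w e e' ∂(Measure.pi fun _ => gaussianReal 0 v) =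
      ((if l = k then 1 else v * (f ⬝ᵥ g)) •
        Matrix.vecMulVec (Matrix.vec 1) (Matrix.vec 1) : Matrix _ _ ℝ) e e' := by
  obtain rfl | h := eq_or_ne l k
  · simp [pairMatrix]
  · simp only [pairMatrix_of_ne_apply h]
    rw [integral_dual_mul_dual (integral_id_pi_gaussianReal v),
      covarianceBilinDual_pi_gaussianReal, siteVector_dotProduct_siteVector]
    simp [h, Matrix.vecMulVec_apply, Matrix.one_apply, eq_comm]

/-- The indicator of the quadruples whose entries agree along the `p`-th of the three pairings
of the four positions. -/
def pairing {β : Type*} [DecidableEq β] (p : Fin 3) (e : (β × β) × (β × β)) : ℝ :=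
  let δ : Matrix β β ℝ := 1
  ![δ e.1.1 e.1.2 * δ e.2.1 e.2.2, δ e.1.1 e.2.1 * δ e.1.2 e.2.2,
    δ e.1.1 e.2.2 * δ e.1.2 e.2.1] p

theorem pairing_dotProduct_pairing {β : Type*} [DecidableEq β] [Fintype β] (p q : Fin 3) :
    pairing p ⬝ᵥ pairing (β := β) q =
      if p = q then (Fintype.card β : ℝ) ^ 2 else Fintype.card β := by
  have hne (h : p ≠ q) (a b c d : β) : pairing p ((a, b), (c, d)) * pairing q ((a, b), (c, d)) =
      if a = b then if a = c then if a = d then (1 : ℝ) else 0 else 0 else 0 := by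
    fin_cases p <;> fin_cases q <;>
      simp only [pairing, Matrix.one_apply, Fin.reduceFinMk, Fin.zero_eta, Fin.mk_one, ne_eq,
        not_true_eq_false, Matrix.cons_val] at h ⊢ <;>
      grind
  simp only [dotProduct, Fintype.sum_prod_type]
  by_cases h : p = q
  · subst h
    fin_cases p <;> simp [pairing, sq, Matrix.one_apply]
  · simp [hne h, h]

/-- The weight of the pairing `p` in the fourth moment of a site. -/
def pairingWeight (f g : Fin r → ℝ) (p : Fin 3) : ℝ :=
  ![(f ⬝ᵥ g) ^ 2, (f ⬝ᵥ f) * (g ⬝ᵥ g), (f ⬝ᵥ g) ^ 2] p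

theorem integral_pairMatrix_kronecker_pairMatrix (e : (Fin N × Fin N) × (Fin N × Fin N))
    (e' : (Fin M × Fin M) × (Fin M × Fin M)) :
    ∫ w, (pairMatrix k l f g w ⊗ₖ pairMatrix k l f g w) e e'
        ∂(Measure.pi fun _ => gaussianReal 0 v) =
      (∑ p, (if l = k then if p = 0 then 1 else 0 else (v : ℝ) ^ 2 * pairingWeight f g p) •
        Matrix.vecMulVec (pairing p) (pairing p)) e e' := by
  simp only [Matrix.kroneckerMap_apply, Matrix.sum_apply, Matrix.smul_apply, Matrix.vecMulVec_apply,
    Fin.sum_univ_three, smul_eq_mul]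
  obtain rfl | h := eq_or_ne l k
  · simp only [pairMatrix, pairing, Matrix.vecMulVec_apply, Matrix.vec, Matrix.one_apply, eq_comm,
      if_true, integral_const, probReal_univ, one_smul, zero_ne_one, Fin.reduceEq, if_false,
      Matrix.cons_val, zero_mul, one_mul, add_zero]
    grind
  · simp only [pairMatrix_of_ne_apply h]
    rw [integral_dual_mul_four (integral_id_pi_gaussianReal v)]
    simp only [covarianceBilinDual_pi_gaussianReal, siteVector_dotProduct_siteVector,
      pairing, h, if_false, pairingWeight, Matrix.cons_val, dotProduct_comm g f]
    ring

end SiteMoments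

section Integration

variable {𝕜 : Type*} [RCLike 𝕜] {n : ℕ} [NeZero n] {β : Fin n → Type*} [∀ l, Fintype (β l)]
  {Ω : Fin n → Type*} [∀ l, MeasurableSpace (Ω l)] {ν : ∀ l, Measure (Ω l)}
  [∀ l, SigmaFinite (ν l)] {T : ∀ l, Ω l → Matrix (β l) (β (l + 1)) 𝕜}

theorem integrable_cyclicTrace (hT : ∀ l a b, Integrable (fun w => T l w a b) (ν l)) :
    Integrable (fun ω => cyclicTrace fun l => T l (ω l)) (Measure.pi ν) := by
  simp only [cyclicTrace_apply]
  exact integrable_finsetSum _ fun c _ =>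
    Integrable.fintype_prod_dep fun l => hT l (c l) (c (l + 1))

theorem integral_cyclicTrace (hT : ∀ l a b, Integrable (fun w => T l w a b) (ν l)) :
    ∫ ω, cyclicTrace (fun l => T l (ω l)) ∂(Measure.pi ν) =
      cyclicTrace fun l => Matrix.of fun a b => ∫ w, T l w a b ∂(ν l) := by
  simp only [cyclicTrace_apply, Matrix.of_apply]
  rw [integral_finsetSum _ fun c _ => Integrable.fintype_prod_dep fun l => hT l (c l) (c (l + 1))]
  exact Finset.sum_congr rfl fun c _ =>
    integral_fintype_prod_eq_prod fun l w => T l w (c l) (c (l + 1))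

end Integration

section Normalization

variable {n : ℕ} [NeZero n]

theorem learningRate_eq_inv_sqrt (α : Fin n → ℕ+) (k : Fin n) :
    learningRate α k = (√((α k : ℝ) * (α (k + 1) : ℝ)))⁻¹ := by
  rw [learningRate, Real.rpow_neg (by positivity), Real.sqrt_eq_rpow]

theorem coe_initVariance (σ : Fin n → ℝ) (α : Fin n → ℕ+) (k : Fin n) :
    (initVariance σ α k : ℝ) = learningRate α k * σ k ^ 2 := by
  rw [learningRate_eq_inv_sqrt, mul_comm]
  rfl

theorem prod_learningRate (α : Fin n → ℕ+) :
    ∏ l, learningRate α l = (∏ l, (α l : ℝ))⁻¹ := by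
  have hshift : ∏ l, √(α (l + 1) : ℝ) = ∏ l, √(α l : ℝ) :=
    Equiv.prod_comp (Equiv.addRight (1 : Fin n)) fun l => √(α l : ℝ)
  simp only [learningRate_eq_inv_sqrt, Finset.prod_inv_distrib,
    Real.sqrt_mul (Nat.cast_nonneg _), Finset.prod_mul_distrib, hshift]
  rw [← Finset.prod_mul_distrib]
  simp only [Real.mul_self_sqrt (Nat.cast_nonneg _)]

theorem learningRate_mul_prod_initVariance (σ : Fin n → ℝ) (α : Fin n → ℕ+) (k : Fin n) :
    learningRate α k * ∏ l ∈ Finset.univ.erase k, (initVariance σ α l : ℝ) =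
      (∏ l, (α l : ℝ))⁻¹ * ∏ l ∈ Finset.univ.erase k, σ l ^ 2 := by
  simp only [coe_initVariance, Finset.prod_mul_distrib]
  rw [← mul_assoc, Finset.mul_prod_erase _ _ (Finset.mem_univ k), prod_learningRate]

theorem prod_ite_eq_mul_prod_erase {ι R : Type*} [Fintype ι] [DecidableEq ι] [CommMonoid R]
    (k : ι) (a b : ι → R) :
    ∏ l, (if l = k then a l else b l) = a k * ∏ l ∈ Finset.univ.erase k, b l := by
  rw [← Finset.mul_prod_erase _ _ (Finset.mem_univ k), if_pos rfl]
  exact congrArg _ (Finset.prod_congr rfl fun l hl => if_neg (Finset.ne_of_mem_erase hl))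

end Normalization

section OverlapMoments

open scoped Kronecker

variable {n : ℕ} [NeZero n] {d : Fin n → ℕ} (u v : (k : Fin n) → Fin (d k) → ℝ) (k : Fin n)
  (σ : Fin n → ℝ) (α : Fin n → ℕ+)

/-- The law of the site tensors at initialization. -/
def initLaw (d : Fin n → ℕ) (σ : Fin n → ℝ) (α : Fin n → ℕ+) : Measure (SiteTensors d α) :=
  Measure.pi fun k => Measure.pi fun _ => gaussianReal 0 (initVariance σ α k)

instance isProbabilityMeasure_initLaw : IsProbabilityMeasure (initLaw d σ α) := by
  unfold initLaw
  infer_instance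

theorem overlap_sq (W : SiteTensors d α) :
    overlap u v k W ^ 2 = cyclicTrace
      (β := fun l => (Fin (α l : ℕ) × Fin (α l : ℕ)) × (Fin (α l : ℕ) × Fin (α l : ℕ)))
      fun l => pairMatrix k l (u l) (v l) (W l) ⊗ₖ pairMatrix k l (u l) (v l) (W l) := by
  rw [overlap_eq_cyclicTrace, sq, cyclicTrace_mul_cyclicTrace]

theorem integrable_overlap : Integrable (overlap u v k) (initLaw d σ α) := by
  rw [funext (overlap_eq_cyclicTrace u v k)]
  exact integrable_cyclicTrace fun l e e' =>
    (memLp_two_pairMatrix k l _ (u l) (v l) e e').integrable one_le_two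

theorem memLp_two_overlap : MemLp (overlap u v k) 2 (initLaw d σ α) := by
  rw [memLp_two_iff_integrable_sq (integrable_overlap u v k σ α).aestronglyMeasurable]
  simp only [overlap_sq]
  exact integrable_cyclicTrace fun l =>
    integrable_pairMatrix_kronecker_pairMatrix k l _ (u l) (v l)

theorem learningRate_mul_integral_overlap :
    learningRate α k * ∫ W, overlap u v k W ∂(initLaw d σ α) =
      ∏ l ∈ Finset.univ.erase k, σ l ^ 2 * (u l ⬝ᵥ v l) := by
  have hmean : ∫ W, overlap u v k W ∂(initLaw d σ α) =
      (∏ l ∈ Finset.univ.erase k, (initVariance σ α l * (u l ⬝ᵥ v l) : ℝ)) * ∏ l, (α l : ℝ) := by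
    simp only [overlap_eq_cyclicTrace, initLaw]
    rw [integral_cyclicTrace fun l e e' =>
      (memLp_two_pairMatrix k l _ (u l) (v l) e e').integrable one_le_two]
    simp only [integral_pairMatrix]
    let vecOne (l : Fin n) := Matrix.vec (1 : Matrix (Fin (α l)) (Fin (α l)) ℝ)
    refine (cyclicTrace_smul_vecMulVec _ vecOne vecOne).trans ?_
    simp [vecOne, prod_ite_eq_mul_prod_erase, Matrix.vec_dotProduct_vec]
  have hα : ∏ l, (α l : ℝ) ≠ 0 := Finset.prod_ne_zero_iff.2 fun l _ => by simp
  rw [hmean, Finset.prod_mul_distrib, Finset.prod_mul_distrib, mul_assoc, ← mul_assoc,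
    learningRate_mul_prod_initVariance]
  field_simp

theorem integral_overlap_sq :
    ∫ W, overlap u v k W ^ 2 ∂(initLaw d σ α) =
      ∑ p : Fin n → Fin 3, (∏ l, if l = k then if p l = 0 then 1 else 0 else
          (initVariance σ α l : ℝ) ^ 2 * pairingWeight (u l) (v l) (p l)) *
        ∏ l, pairing (β := Fin (α l : ℕ)) (p l) ⬝ᵥ pairing (p (l - 1)) := by
  simp only [overlap_sq, initLaw]
  rw [integral_cyclicTrace fun l => integrable_pairMatrix_kronecker_pairMatrix k l _ (u l) (v l)]
  simp only [integral_pairMatrix_kronecker_pairMatrix]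
  exact cyclicTrace_sum_smul_vecMulVec
    (fun l p => if l = k then if p = 0 then 1 else 0 else
      (initVariance σ α l : ℝ) ^ 2 * pairingWeight (u l) (v l) p)
    fun l => pairing (β := Fin (α l : ℕ))

/-- The contribution of the choice `p` of a pairing at every site to the normalized second moment
of the overlap, as a function of the inverse bond dimensions `t`. -/
def pairingContribution (p : Fin n → Fin 3) (t : Fin n → ℝ) : ℝ :=
  ((if p k = 0 then 1 else 0) *
      ∏ l ∈ Finset.univ.erase k, (σ l ^ 2) ^ 2 * pairingWeight (u l) (v l) (p l)) *
    ∏ l, if p l = p (l - 1) then 1 else t l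

theorem learningRate_sq_mul_integral_overlap_sq :
    learningRate α k ^ 2 * ∫ W, overlap u v k W ^ 2 ∂(initLaw d σ α) =
      ∑ p, pairingContribution u v k σ p fun l => (α l : ℝ)⁻¹ := by
  rw [integral_overlap_sq, Finset.mul_sum]
  refine Finset.sum_congr rfl fun p _ => ?_
  have hα (l : Fin n) : (α l : ℝ) ≠ 0 := by simp
  have hprod : ∏ l, (α l : ℝ) ≠ 0 := Finset.prod_ne_zero_iff.2 fun l _ => hα l
  have hpairing (l : Fin n) : pairing (β := Fin (α l : ℕ)) (p l) ⬝ᵥ pairing (p (l - 1)) =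
      (α l : ℝ) ^ 2 * if p l = p (l - 1) then 1 else (α l : ℝ)⁻¹ := by
    rw [pairing_dotProduct_pairing, Fintype.card_fin, mul_ite, mul_one, sq,
      mul_inv_cancel_right₀ (hα l)]
  have hnorm := congrArg (· ^ 2) (learningRate_mul_prod_initVariance σ α k)
  simp only [mul_pow, inv_pow, ← Finset.prod_pow] at hnorm
  simp only [pairingContribution, hpairing, prod_ite_eq_mul_prod_erase, Finset.prod_mul_distrib,
    Finset.prod_pow _ 2 (fun l => (α l : ℝ))] at hnorm ⊢
  field_simp at hnorm ⊢
  rw [hnorm]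

end OverlapMoments

section SecondMomentLimit

variable {n : ℕ} [NeZero n]

theorem eq_of_forall_eq_sub_one {κ : Type*} {p : Fin n → κ} (h : ∀ l, p l = p (l - 1))
    (k l : Fin n) : p l = p k := by
  obtain ⟨m, rfl⟩ : ∃ m, n = m + 1 := ⟨n - 1, (Nat.succ_pred (NeZero.ne n)).symm⟩
  have hzero (l : Fin (m + 1)) : p l = p 0 := by
    induction l using Fin.induction with
    | zero => rfl
    | succ i ih => rw [← ih, h i.succ, ← Fin.coeSucc_eq_succ, add_sub_cancel_right]
  rw [hzero l, hzero k]

variable {d : Fin n → ℕ} (u v : (k : Fin n) → Fin (d k) → ℝ) (k : Fin n) (σ : Fin n → ℝ)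

theorem continuous_pairingContribution (p : Fin n → Fin 3) :
    Continuous (pairingContribution u v k σ p) := by
  refine continuous_const.mul (continuous_finsetProd _ fun l _ => ?_)
  split_ifs <;> fun_prop

theorem pairingContribution_zero_of_ne {p : Fin n → Fin 3} (hp : p ≠ 0) :
    pairingContribution u v k σ p 0 = 0 := by
  by_cases h : ∀ l, p l = p (l - 1)
  · have hk : p k ≠ 0 := fun hk => hp (funext fun l => (eq_of_forall_eq_sub_one h k l).trans hk)
    simp [pairingContribution, hk]
  · obtain ⟨l, hl⟩ := not_forall.1 h
    exact mul_eq_zero_of_right _ (Finset.prod_eq_zero (Finset.mem_univ l) (if_neg hl))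

theorem sum_pairingContribution_zero :
    ∑ p, pairingContribution u v k σ p 0 =
      (∏ l ∈ Finset.univ.erase k, σ l ^ 2 * (u l ⬝ᵥ v l)) ^ 2 := by
  rw [Fintype.sum_eq_single 0 fun p hp => pairingContribution_zero_of_ne u v k σ hp]
  simp [pairingContribution, pairingWeight, mul_pow, ← Finset.prod_pow]

variable {F : Filter (Fin n → ℕ+)}

theorem tendsto_learningRate_sq_mul_integral_overlap_sq
    (hF : ∀ l, Tendsto (fun α : Fin n → ℕ+ => α l) F atTop) :
    Tendsto (fun α => learningRate α k ^ 2 * ∫ W, overlap u v k W ^ 2 ∂(initLaw d σ α)) F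
      (𝓝 ((∏ l ∈ Finset.univ.erase k, σ l ^ 2 * (u l ⬝ᵥ v l)) ^ 2)) := by
  have hinv : Tendsto (fun (α : Fin n → ℕ+) l => (α l : ℝ)⁻¹) F (𝓝 0) :=
    tendsto_pi_nhds.2 fun l => tendsto_inv_atTop_zero.comp
      (tendsto_natCast_atTop_atTop.comp (tendsto_PNat_val_atTop_atTop.comp (hF l)))
  simp only [learningRate_sq_mul_integral_overlap_sq, ← sum_pairingContribution_zero]
  exact tendsto_finsetSum _ fun p _ =>
    ((continuous_pairingContribution u v k σ p).tendsto 0).comp hinv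

theorem tendsto_variance_learningRate_mul_overlap
    (hF : ∀ l, Tendsto (fun α : Fin n → ℕ+ => α l) F atTop) :
    Tendsto (fun α => Var[fun W => learningRate α k * overlap u v k W; initLaw d σ α]) F
      (𝓝 0) := by
  have hvar (α : Fin n → ℕ+) :
      Var[fun W => learningRate α k * overlap u v k W; initLaw d σ α] =
        learningRate α k ^ 2 * ∫ W, overlap u v k W ^ 2 ∂(initLaw d σ α) -
          (∏ l ∈ Finset.univ.erase k, σ l ^ 2 * (u l ⬝ᵥ v l)) ^ 2 := by
    rw [variance_const_mul, variance_eq_sub (memLp_two_overlap u v k σ α), mul_sub, ← mul_pow,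
      learningRate_mul_integral_overlap]
    rfl
  simp only [hvar]
  exact tendsto_sub_nhds_zero_iff.2 (tendsto_learningRate_sq_mul_integral_overlap_sq u v k σ hF)

end SecondMomentLimit

section ConvergenceInProbability

variable {Ω ι : Type*} [MeasurableSpace Ω] {μ : Measure Ω} {F : Filter ι}

theorem tendstoInMeasure_const_of_tendsto_variance [IsFiniteMeasure μ] {f : ι → Ω → ℝ} {c : ℝ}
    (hf : ∀ i, MemLp (f i) 2 μ) (hmean : ∀ i, μ[f i] = c)
    (hvar : Tendsto (fun i => Var[f i; μ]) F (𝓝 0)) :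
    TendstoInMeasure μ f F fun _ => c := by
  refine tendstoInMeasure_iff_dist.2 fun ε hε => ?_
  have hbound : Tendsto (fun i => ENNReal.ofReal (Var[f i; μ] / ε ^ 2)) F (𝓝 0) := by
    simpa using ENNReal.tendsto_ofReal (hvar.div_const (ε ^ 2))
  refine tendsto_of_tendsto_of_tendsto_of_le_of_le tendsto_const_nhds hbound
    (fun _ => zero_le) fun i => ?_
  simpa only [hmean, Real.dist_eq] using meas_ge_le_variance_div_sq (hf i) hε

theorem tendstoInMeasure_pi {κ : Type*} [Fintype κ] {E : κ → Type*}
    [∀ k, PseudoEMetricSpace (E k)] {f : ι → Ω → ∀ k, E k} {g : Ω → ∀ k, E k}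
    (h : ∀ k, TendstoInMeasure μ (fun i ω => f i ω k) F fun ω => g ω k) :
    TendstoInMeasure μ f F g := by
  intro ε hε
  have hsum : Tendsto (fun i => ∑ k, μ {ω | ε ≤ edist (f i ω k) (g ω k)}) F (𝓝 0) := by
    simpa using tendsto_finsetSum Finset.univ fun k _ => h k ε hε
  refine tendsto_of_tendsto_of_tendsto_of_le_of_le tendsto_const_nhds hsum
    (fun _ => zero_le) fun i => (measure_mono fun ω hω => ?_).trans
      (measure_iUnion_fintype_le μ _)
  obtain ⟨k, -, hk⟩ := (Finset.le_sup_iff hε).1 hω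
  exact Set.mem_iUnion.2 ⟨k, hk⟩

theorem tendstoInMeasure_const_comp {E E' : Type*} [PseudoEMetricSpace E] [PseudoEMetricSpace E']
    {f : ι → Ω → E} {c : E} (h : TendstoInMeasure μ f F fun _ => c) {g : E → E'}
    (hg : ContinuousAt g c) : TendstoInMeasure μ (fun i ω => g (f i ω)) F fun _ => g c := by
  intro ε hε
  obtain ⟨δ, hδ, hgδ⟩ := EMetric.continuousAt_iff.1 hg ε hε
  refine tendsto_of_tendsto_of_tendsto_of_le_of_le tendsto_const_nhds (h δ hδ)
    (fun _ => zero_le) fun i => measure_mono fun ω hω => ?_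
  exact not_lt.1 fun hlt => (hgδ hlt).not_ge hω

end ConvergenceInProbability

section Initialization

variable {n : ℕ} [NeZero n] {d : Fin n → ℕ} {σ : Fin n → ℝ} {Ω : Type*} [MeasurableSpace Ω]
  {μ : Measure Ω}

theorem IsGaussianInit.hasLaw_curry {α : Fin n → ℕ+} {A : Ω → Param d α → ℝ}
    (hA : IsGaussianInit μ σ α A) :
    HasLaw (fun ω => (Sigma.curry (A ω) : SiteTensors d α)) (initLaw d σ α) μ := by
  have hcurry := Measure.infinitePi_map_piCurry
    (κ := fun k : Fin n => Fin (d k) × Fin (α k : ℕ) × Fin (α (k + 1) : ℕ))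
    (X := fun _ _ => ℝ) fun k _ => gaussianReal 0 (initVariance σ α k)
  simp only [Measure.infinitePi_eq_pi] at hcurry
  exact HasLaw.comp ⟨by fun_prop, hcurry⟩ (hA.indep.hasLaw_pi hA.law)

theorem tendstoInMeasure_learningRate_mul_overlap {A : (α : Fin n → ℕ+) → Ω → Param d α → ℝ}
    (hA : ∀ α, IsGaussianInit μ σ α (A α)) {F : Filter (Fin n → ℕ+)}
    (hF : ∀ l, Tendsto (fun α : Fin n → ℕ+ => α l) F atTop)
    (u v : (k : Fin n) → Fin (d k) → ℝ) (k : Fin n) :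
    TendstoInMeasure μ
      (fun α ω => learningRate α k * overlap u v k (Sigma.curry (A α ω))) F
      fun _ => ∏ l ∈ Finset.univ.erase k, σ l ^ 2 * (u l ⬝ᵥ v l) := by
  have := (hA 1).hasLaw_curry.isProbabilityMeasure
  have hL2 (α : Fin n → ℕ+) :
      MemLp (fun W => learningRate α k * overlap u v k W) 2 (initLaw d σ α) :=
    (memLp_two_overlap u v k σ α).const_mul _
  have hmap (α : Fin n → ℕ+) := (hA α).hasLaw_curry.map_eq
  have hcurry (α : Fin n → ℕ+) := (hA α).hasLaw_curry.aemeasurable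
  refine tendstoInMeasure_const_of_tendsto_variance (fun α => ?_) (fun α => ?_) ?_
  · exact (hmap α ▸ hL2 α).comp_of_map (hcurry α)
  · exact ((hA α).hasLaw_curry.integral_comp (hL2 α).aestronglyMeasurable).trans
      ((integral_const_mul _ _).trans (learningRate_mul_integral_overlap u v k σ α))
  · refine (tendsto_variance_learningRate_mul_overlap u v k σ hF).congr fun α => ?_
    rw [← hmap α, variance_map (hmap α ▸ (hL2 α).aestronglyMeasurable.aemeasurable) (hcurry α)]
    rfl

end Initialization

section IteratedLimit

variable {n : ℕ}

theorem eventually_iteratedAtTop_eq {ks : List (Fin n)} {j : Fin n} (hj : j ∉ ks)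
    (α : Fin n → ℕ+) : ∀ᶠ β in iteratedAtTop ks α, β j = α j := by
  induction ks generalizing α with
  | nil => simp [iteratedAtTop]
  | cons k ks ih =>
    rw [List.mem_cons, not_or] at hj
    rw [iteratedAtTop, eventually_bind]
    refine Eventually.of_forall fun N => (ih hj.2 _).mono fun β hβ => ?_
    rw [hβ, Function.update_of_ne hj.1]

theorem tendsto_iteratedAtTop {ks : List (Fin n)} (hks : ks.Nodup) {j : Fin n} (hj : j ∈ ks)
    (α : Fin n → ℕ+) : Tendsto (fun β : Fin n → ℕ+ => β j) (iteratedAtTop ks α) atTop := by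
  induction ks generalizing α with
  | nil => simp at hj
  | cons k ks ih =>
    rw [List.nodup_cons] at hks
    rw [tendsto_atTop]
    intro b
    rw [iteratedAtTop, eventually_bind]
    by_cases h : j ∈ ks
    · exact Eventually.of_forall fun N => tendsto_atTop.1 (ih hks.2 h _) b
    · obtain rfl : j = k := by simpa [h] using hj
      filter_upwards [eventually_ge_atTop b] with N hN
      filter_upwards [eventually_iteratedAtTop_eq h (Function.update α j N)] with β hβ
      rwa [hβ, Function.update_self]

theorem tendsto_sequentialAtTop (π : Equiv.Perm (Fin n)) (j : Fin n) :
    Tendsto (fun α : Fin n → ℕ+ => α j) (sequentialAtTop π) atTop := by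
  refine tendsto_iteratedAtTop ?_ ?_ _
  · rw [List.nodup_reverse, List.nodup_ofFn]
    exact π.injective
  · rw [List.mem_reverse, List.mem_ofFn]
    exact π.surjective j

end IteratedLimit

end MPS

end

theorem theorem2_general {n : ℕ} [NeZero n] {ι : Type*} [Fintype ι] {d : Fin n → ℕ}
    {X : Fin n → Type*} (φ : (k : Fin n) → X k → Fin (d k) → ℝ) (σ : Fin n → ℝ)
    (x : ι → (k : Fin n) → X k) {Ω : Type*} [MeasurableSpace Ω] (μ : Measure Ω)
    (A : (α : Fin n → ℕ+) → Ω → MPS.Param d α → ℝ)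
    (hA : ∀ α : Fin n → ℕ+, MPS.IsGaussianInit μ σ α (A α))
    {F : Filter (Fin n → ℕ+)} (hF : ∀ k, Tendsto (fun α : Fin n → ℕ+ => α k) F atTop) :
    TendstoInMeasure μ (fun α ω i j => MPS.ntk φ α (A α ω) (x i) (x j)) F
      (fun _ i j => MPS.limitKernel φ σ (x i) (x j)) := by
  have hoverlap : TendstoInMeasure μ
      (fun α ω (q : ι × ι × Fin n) => MPS.learningRate α q.2.2 * MPS.overlap
        (fun l => φ l (x q.1 l)) (fun l => φ l (x q.2.1 l)) q.2.2 (Sigma.curry (A α ω))) F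
      fun _ q => ∏ l ∈ Finset.univ.erase q.2.2, σ l ^ 2 * (φ l (x q.1 l) ⬝ᵥ φ l (x q.2.1 l)) :=
    MPS.tendstoInMeasure_pi fun q => MPS.tendstoInMeasure_learningRate_mul_overlap hA hF _ _ q.2.2
  have hsum : Continuous fun (t : ι × ι × Fin n → ℝ) i j =>
      ∑ k, (φ k (x i k) ⬝ᵥ φ k (x j k)) * t (i, j, k) := by
    fun_prop
  simpa only [MPS.ntk_eq_sum_overlap, MPS.limitKernel] using
    MPS.tendstoInMeasure_const_comp hoverlap hsum.continuousAt

theorem theorem2 {n : ℕ} [NeZero n] {m : ℕ} {d : Fin n → ℕ} {X : Fin n → Type*}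
    (φ : (k : Fin n) → X k → Fin (d k) → ℝ) (σ : Fin n → ℝ)
    (x : Fin m → (k : Fin n) → X k)
    {Ω : Type*} [MeasurableSpace Ω] (μ : Measure Ω) [IsProbabilityMeasure μ]
    (A : (α : Fin n → ℕ+) → Ω → MPS.Param d α → ℝ)
    (hA : ∀ α : Fin n → ℕ+, MPS.IsGaussianInit μ σ α (A α))
    (π : Equiv.Perm (Fin n)) :
    TendstoInMeasure μ
      (fun (α : Fin n → ℕ+) (ω : Ω) (i j : Fin m) => MPS.ntk φ α (A α ω) (x i) (x j))
      (MPS.sequentialAtTop π)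
      (fun (_ : Ω) (i j : Fin m) => MPS.limitKernel φ σ (x i) (x j)) := by
  exact theorem2_general φ σ x μ A hA (MPS.tendsto_sequentialAtTop π)
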